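/- Let $H\in\mathbb R^{n\times n}$, $f\in\mathbb R^n$, $A\in\mathbb R^{m\times n}$, $b\in\mathbb R^m$ and $\rho>0$, and let $\mathcal X=\{x\in\mathbb R^n: Ax\le b\}$ be nonempty. The affine variational inequality (AVI) asks for $x\in\mathcal X$ with $(Hx+f)^\top(y-x)\ge 0$ for all $y\in\mathcal X$; its KKT conditions are $Hx+f+A^\top\lambda=0$, $0\le\lambda\perp b-Ax\ge 0$. For $x\in\mathbb R^n$ write $\mathcal A(x)=\{i: A_ix=b_i\}$, and let $A_S,b_S$ denote the rows of $A$ and entries of $b$ with index in $S\subseteq\{1,\dots,m\}$. Put $H_s=\tfrac12(H+H^\top)$, $\tilde H=\rho I+H_s$, $\tilde f(z)=f+(H-\tilde H)z$, and let $\mathrm{QP}(z)$ be the problem of minimizing $\tfrac12x^\top\tilde Hx+\tilde f(z)^\top x$ subject to $Ax\le b$. Consider the following algorithm (DR-DAQP), started from an arbitrary $z_0\in\mathbb R^n$ with $\delta=\infty$ and with $\mathcal A_{-1}$ either undefined (so that the test in step 2 fails for $k=0$) or an arbitrary index set. For $k=0,1,2,\dots$: 1. Let $y_k$ be the solution of $\mathrm{QP}(z_k)$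 and $\mathcal A_k=\mathcal A(y_k)$. 2. If $\mathcal A_k=\mathcal A_{k-1}$: (a) let $(\tilde z_k,\lambda_k)$ be a solution of the linear system $H\tilde z+A_{S}^\top\lambda=-f$, $A_{S}\tilde z=b_{S}$ with $S=\mathcal A_k$; (b) if $\lambda_k\ge0$ and $A\tilde z_k\le b$, return $(\tilde z_k,\lambda_k)$, where $\lambda_k$ is extended by zero to the indices outside $S$; (c) otherwise let $\tilde y_k$ be the solution of $\mathrm{QP}(\tilde z_k)$ and overwrite $\mathcal A_k\leftarrow\mathcal A(\tilde y_k)$; if $\|\tilde y_k-\tilde z_k\|<\delta$ (Euclidean norm), set $y_k\leftarrow\tilde y_k$, $z_k\leftarrow\tilde z_k$, $\delta\leftarrow\|\tilde y_k-\tilde z_k\|$. 3. Set $z_{k+1}=(\rho I+H)^{-1}\bigl(\rho y_k+Hz_k+\tfrac12H_s(y_k-z_k)\bigr)$. Assume that $H+H^\top$ is positive definite, that the rows of $A_{\mathcal A(x^*)}$ are linearly independent at the solution $x^*$ of the AVI (LICQ), and that the KKT multiplier $\lambda^*$ satisfies $\lambda^*_i>0$ for all $i\in\mathcal A(x^*)$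 (strict complementarity). Then the AVI has exactly one solution $x^*$, there is exactly one pair $(x^*,\lambda^*)$ satisfying the KKT conditions, and for every starting point the algorithm is well defined (every step that is reached can be carried out) and, whichever solutions of the linear systems are computed in step 2(a), it returns exactly $(x^*,\lambda^*)$ after finitely many iterations; their number is bounded by some $N$ depending only on the data and the start $(z_0,\mathcal A_{-1})$. -/

import Mathlib

open scoped Matrix ENNReal

noncomputable section

/-- The data of an affine variational inequality over the polyhedron `{x | A x ≤ b}`. -/
structure AVI (n m : ℕ) where
  H : Matrix (Fin n) (Fin n) ℝ
  f : Fin n → ℝ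
  A : Matrix (Fin m) (Fin n) ℝ
  b : Fin m → ℝ

namespace AVI

variable {n m : ℕ} (P : AVI n m)

/-- The feasible polyhedron `{x | A x ≤ b}` (componentwise order). -/
def feasible : Set (Fin n → ℝ) := {x | P.A *ᵥ x ≤ P.b}

/-- `x` is feasible and `(H x + f)ᵀ (y - x) ≥ 0` for every feasible `y`. -/
def IsSolution (x : Fin n → ℝ) : Prop :=
  x ∈ P.feasible ∧ ∀ y ∈ P.feasible, 0 ≤ (P.H *ᵥ x + P.f) ⬝ᵥ (y - x)

/-- The KKT conditions `H x + f + Aᵀ l = 0` and `0 ≤ l ⟂ b - A x ≥ 0`. -/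
def IsKKT (x : Fin n → ℝ) (l : Fin m → ℝ) : Prop :=
  P.H *ᵥ x + P.f + P.Aᵀ *ᵥ l = 0 ∧
    0 ≤ l ∧ 0 ≤ P.b - P.A *ᵥ x ∧ l ⬝ᵥ (P.b - P.A *ᵥ x) = 0

/-- The indices `i` with `A_i x = b_i`. -/
def activeSet (x : Fin n → ℝ) : Finset (Fin m) :=
  Finset.univ.filter fun i => (P.A *ᵥ x) i = P.b i

/-- The submatrix of `A` made of the rows with index in `S`. -/
def rows (S : Finset (Fin m)) : Matrix S (Fin n) ℝ :=
  P.A.submatrix Subtype.val id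

/-- The rows of `A` that are active at `x` are linearly independent. -/
def LICQ (x : Fin n → ℝ) : Prop :=
  LinearIndependent ℝ (P.rows (P.activeSet x)).row

/-- The symmetric part of `H`. -/
def Hs : Matrix (Fin n) (Fin n) ℝ := (1 / 2 : ℝ) • (P.H + P.Hᵀ)

/-- The Hessian `ρ I + H_s` of the quadratic-program subproblem. -/
def Ht (ρ : ℝ) : Matrix (Fin n) (Fin n) ℝ := ρ • 1 + P.Hs

/-- The linear term `f + (H - (ρ I + H_s)) z` of the quadratic-program subproblem. -/
def ft (ρ : ℝ) (z : Fin n → ℝ) : Fin n → ℝ := P.f + (P.H - P.Ht ρ) *ᵥ z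

/-- The objective of the quadratic-program subproblem with parameter `z`. -/
def qpObj (ρ : ℝ) (z x : Fin n → ℝ) : ℝ :=
  (1 / 2) * (x ⬝ᵥ (P.Ht ρ *ᵥ x)) + P.ft ρ z ⬝ᵥ x

/-- `y` minimizes the objective with parameter `z` over the feasible polyhedron. -/
def IsQPSolution (ρ : ℝ) (z y : Fin n → ℝ) : Prop :=
  y ∈ P.feasible ∧ IsMinOn (P.qpObj ρ z) P.feasible y

/-- `(x, μ)` solves the linear system `[H, A_Sᵀ; A_S, 0] [x; μ] = [-f; b_S]`. -/
def SolvesKKTSystem (S : Finset (Fin m)) (x : Fin n → ℝ) (μ : S → ℝ) : Prop :=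
  Matrix.fromBlocks P.H (P.rows S)ᵀ (P.rows S) 0 *ᵥ Sum.elim x μ =
    Sum.elim (-P.f) (fun i : S => P.b i)

/-- The Douglas-Rachford update `(ρ I + H)⁻¹ (ρ y + H z + (H_s / 2) (y - z))`. -/
def drUpdate (ρ : ℝ) (z y : Fin n → ℝ) : Fin n → ℝ :=
  (ρ • 1 + P.H)⁻¹ *ᵥ (ρ • y + P.H *ᵥ z + ((1 / 2 : ℝ) • P.Hs) *ᵥ (y - z))

/-- The Euclidean norm, as an extended nonnegative real. -/
def euclNorm (v : Fin n → ℝ) : ℝ≥0∞ := ‖WithLp.toLp 2 v‖ₑ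

/-- A vector of multipliers indexed by `S`, extended by zero to all the constraints. -/
def extendZero (S : Finset (Fin m)) (μ : S → ℝ) : Fin m → ℝ :=
  fun i => if h : i ∈ S then μ ⟨i, h⟩ else 0

/-- The variables of the hybrid method at the beginning of an iteration: the iterate `z`, the
active set stored by the previous iteration (`none` if there is none), and the residual `δ` of the
last accepted Newton step. -/
structure State (n m : ℕ) where
  z : Fin n → ℝ
  prev : Option (Finset (Fin m))
  δ : ℝ≥0∞

/-- What one iteration leads to: the method goes on from a new state, or returns a pair. -/
inductive Outcome (n m : ℕ) where
  | next (s : State n m)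
  | done (x : Fin n → ℝ) (l : Fin m → ℝ)

/-- One iteration of the hybrid method. It is a relation because the linear system can have several
solutions `μ` when the selected rows of `A` are dependent; any of them may be the computed one. -/
inductive Step (ρ : ℝ) (s : State n m) : Outcome n m → Prop
  /-- The active set has changed: plain Douglas-Rachford step. -/
  | unstable (y : Fin n → ℝ) (hy : P.IsQPSolution ρ s.z y)
      (hprev : s.prev ≠ some (P.activeSet y)) :
      Step ρ s (.next ⟨P.drUpdate ρ s.z y, some (P.activeSet y), s.δ⟩)
  /-- The active set is stable and the solution of the linear system is primal and dual feasible. -/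
  | terminate (y : Fin n → ℝ) (hy : P.IsQPSolution ρ s.z y)
      (hprev : s.prev = some (P.activeSet y))
      (zt : Fin n → ℝ) (μ : P.activeSet y → ℝ) (hsys : P.SolvesKKTSystem (P.activeSet y) zt μ)
      (hfeas : 0 ≤ μ ∧ P.A *ᵥ zt ≤ P.b) :
      Step ρ s (.done zt (extendZero (P.activeSet y) μ))
  /-- The active set is stable, the candidate is infeasible, the Newton step is accepted. -/
  | accept (y : Fin n → ℝ) (hy : P.IsQPSolution ρ s.z y)
      (hprev : s.prev = some (P.activeSet y))
      (zt : Fin n → ℝ) (μ : P.activeSet y → ℝ) (hsys : P.SolvesKKTSystem (P.activeSet y) zt μ)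
      (hfeas : ¬ (0 ≤ μ ∧ P.A *ᵥ zt ≤ P.b))
      (yt : Fin n → ℝ) (hyt : P.IsQPSolution ρ zt yt) (hδ : euclNorm (yt - zt) < s.δ) :
      Step ρ s (.next ⟨P.drUpdate ρ zt yt, some (P.activeSet yt), euclNorm (yt - zt)⟩)
  /-- The active set is stable, the candidate is infeasible, the Newton step is rejected. The stored
  active set is overwritten by that of the second quadratic program also in this case. -/
  | reject (y : Fin n → ℝ) (hy : P.IsQPSolution ρ s.z y)
      (hprev : s.prev = some (P.activeSet y))
      (zt : Fin n → ℝ) (μ : P.activeSet y → ℝ) (hsys : P.SolvesKKTSystem (P.activeSet y) zt μ)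
      (hfeas : ¬ (0 ≤ μ ∧ P.A *ᵥ zt ≤ P.b))
      (yt : Fin n → ℝ) (hyt : P.IsQPSolution ρ zt yt) (hδ : ¬ euclNorm (yt - zt) < s.δ) :
      Step ρ s (.next ⟨P.drUpdate ρ s.z y, some (P.activeSet yt), s.δ⟩)

/-- Every execution from the given state returns the pair `(x, l)` after at most `N` iterations,
and none of them gets stuck: each iteration that is reached can be carried out. -/
def ReturnsWithin (ρ : ℝ) (x : Fin n → ℝ) (l : Fin m → ℝ) : ℕ → State n m → Prop
  | 0, _ => False
  | N + 1, s =>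
      (∃ o, P.Step ρ s o) ∧
        ∀ o, P.Step ρ s o → o = .done x l ∨ ∃ s', o = .next s' ∧ ReturnsWithin ρ x l N s'

end AVI

end

/-!
Let `R = ρ I + H` and `M = ρ I + H_s / 2`. The Douglas-Rachford update reads
`R (z⁺ - z) = M (y - z)`, and monotonicity of the normal cone gives, for the differences `e`, `e⁺`
of two iterates and `d` of the corresponding solutions of the quadratic programs,
`‖R e⁺‖² + eᵀ H e + dᵀ H d ≤ ‖R e‖²` in the norm dual to `M`. As `H + Hᵀ` is positive definite, the
plain iteration is a contraction, so it converges to its only fixed point, the solution of the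
variational inequality; moreover the solution of the quadratic program depends continuously on `z`.

Under LICQ and strict complementarity, the active set of the quadratic program equals that of the
solution for all `z` nearby, and for this index set the linear system has the KKT pair as its only
solution. Hence sufficiently many plain steps in a row lead to termination. The residual of a Newton
step depends only on the index set, because the primal part of the linear system is unique, and it
strictly decreases from one accepted step to the next. So there are at most finitely many accepted
steps, and all the other iterations are plain steps.
-/

open Filter Topology Function

section QuadraticGauge

lemma iterate_sub_le {G : Type*} [AddCommGroup G] {V : G → ℝ} {T : G → G} {q : ℝ} (hq₀ : 0 ≤ q)
    (hT : ∀ x y, V (T x - T y) ≤ q * V (x - y)) (k : ℕ) (x y : G) :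
    V (T^[k] x - T^[k] y) ≤ q ^ k * V (x - y) := by
  induction k with
  | zero => simp
  | succ k ih =>
    rw [iterate_succ_apply', iterate_succ_apply', pow_succ', mul_assoc]
    exact (hT _ _).trans (by gcongr)

variable {E F : Type*} [NormedAddCommGroup E] [NormedSpace ℝ E] [NormedAddCommGroup F]
  [NormedSpace ℝ F]

/-- A continuous positive function that is homogeneous of degree two, such as the squared norm or a
positive definite quadratic form. No triangle inequality is required. -/
structure IsQuadraticGauge (V : E → ℝ) : Prop where
  continuous : Continuous V
  map_smul : ∀ (t : ℝ) (x : E), V (t • x) = t ^ 2 * V x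
  pos : ∀ x ≠ 0, 0 < V x

lemma isQuadraticGauge_norm_sq : IsQuadraticGauge fun x : E => ‖x‖ ^ 2 where
  continuous := by fun_prop
  map_smul t x := by rw [norm_smul, mul_pow, Real.norm_eq_abs, sq_abs]
  pos x hx := by positivity

namespace IsQuadraticGauge

variable {V W : E → ℝ}

lemma map_zero (hV : IsQuadraticGauge V) : V 0 = 0 := by
  simpa using hV.map_smul 0 0

lemma nonneg (hV : IsQuadraticGauge V) (x : E) : 0 ≤ V x := by
  rcases eq_or_ne x 0 with rfl | hx
  · exact hV.map_zero.ge
  · exact (hV.pos x hx).le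

lemma eq_zero_of_nonpos (hV : IsQuadraticGauge V) {x : E} (hx : V x ≤ 0) : x = 0 := by
  by_contra hne
  exact (hV.pos x hne).not_ge hx

lemma comp_injective {V : F → ℝ} (hV : IsQuadraticGauge V) (f : E →L[ℝ] F) (hf : Injective f) :
    IsQuadraticGauge fun x => V (f x) where
  continuous := hV.continuous.comp f.continuous
  map_smul t x := by rw [_root_.map_smul, hV.map_smul]
  pos x hx := hV.pos _ ((map_ne_zero_iff f hf).2 hx)

section FiniteDimensional

variable [FiniteDimensional ℝ E]

lemma exists_le_mul (hV : IsQuadraticGauge V) (hW : IsQuadraticGauge W) :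
    ∃ C, 1 ≤ C ∧ ∀ x, V x ≤ C * W x := by
  have hne : ∀ x ∈ Metric.sphere (0 : E) 1, x ≠ 0 := by
    rintro _ hx rfl
    simp at hx
  obtain ⟨C, hC⟩ := (isCompact_sphere (0 : E) 1).exists_bound_of_continuousOn
    (hV.continuous.continuousOn.div hW.continuous.continuousOn
      fun x hx => (hW.pos x (hne x hx)).ne')
  refine ⟨max C 1, le_max_right _ _, fun x => ?_⟩
  rcases eq_or_ne x 0 with rfl | hx
  · rw [hV.map_zero, hW.map_zero, mul_zero]
  set u := ‖x‖⁻¹ • x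
  have hu : u ∈ Metric.sphere (0 : E) 1 := by simp [u, norm_smul, hx]
  have hVu : V u ≤ max C 1 * W u := by
    rw [← div_le_iff₀ (hW.pos u (hne u hu))]
    exact (le_abs_self _).trans ((hC u hu).trans (le_max_left _ _))
  have hxu : x = ‖x‖ • u := by simp [u, smul_smul, hx]
  rw [hxu, hV.map_smul, hW.map_smul, mul_left_comm]
  gcongr

lemma tendsto_cocompact_atTop (hV : IsQuadraticGauge V) : Tendsto V (cocompact E) atTop := by
  obtain ⟨C, hC, hle⟩ := isQuadraticGauge_norm_sq.exists_le_mul hV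
  have hC₀ : 0 < C := zero_lt_one.trans_le hC
  refine tendsto_atTop_mono (fun x => (inv_mul_le_iff₀ hC₀).2 (hle x)) ?_
  exact ((tendsto_pow_atTop two_ne_zero).comp
    (tendsto_norm_cocompact_atTop (E := E))).const_mul_atTop (inv_pos.2 hC₀)

lemma tendsto_zero {α : Type*} {l : Filter α} {u : α → E} (hV : IsQuadraticGauge V)
    (hu : Tendsto (fun a => V (u a)) l (𝓝 0)) : Tendsto u l (𝓝 0) := by
  obtain ⟨C, -, hle⟩ := isQuadraticGauge_norm_sq.exists_le_mul hV
  have hsq : Tendsto (fun a => ‖u a‖ ^ 2) l (𝓝 0) :=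
    squeeze_zero (fun a => sq_nonneg _) (fun a => hle (u a)) (by simpa using hu.const_mul C)
  rw [tendsto_zero_iff_norm_tendsto_zero]
  simpa using hsq.sqrt

end FiniteDimensional

lemma continuous_of_le [FiniteDimensional ℝ F] {f : E → F} {U : F → ℝ} (hU : IsQuadraticGauge U)
    (hV : IsQuadraticGauge V) (h : ∀ x y, U (f x - f y) ≤ V (x - y)) : Continuous f := by
  refine continuous_iff_continuousAt.2 fun y => ?_
  have hVy : Tendsto (fun x => V (x - y)) (𝓝 y) (𝓝 0) := by
    have hcont : Continuous fun x => V (x - y) := hV.continuous.comp (by fun_prop)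
    exact hcont.tendsto' y 0 (by simp [hV.map_zero])
  exact tendsto_sub_nhds_zero_iff.1
    (hU.tendsto_zero (squeeze_zero (fun x => hU.nonneg _) (fun x => h x y) hVy))

section Contraction

variable [FiniteDimensional ℝ E] {T : E → E} {q : ℝ}

-- In an equivalent norm `T` need not contract, but a high iterate of it does.
lemma exists_isFixedPt (hV : IsQuadraticGauge V) (hq₀ : 0 ≤ q) (hq₁ : q < 1)
    (hT : ∀ x y, V (T x - T y) ≤ q * V (x - y)) : ∃ x, IsFixedPt T x := by
  obtain ⟨C, hC, hnorm_le⟩ := isQuadraticGauge_norm_sq.exists_le_mul hV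
  obtain ⟨D, hD, hle_norm⟩ := hV.exists_le_mul isQuadraticGauge_norm_sq
  have hCD : 0 < C * D := by positivity
  obtain ⟨k, hk⟩ := exists_pow_lt_of_lt_one (show 0 < (1 / 2 : ℝ) ^ 2 / (C * D) by positivity) hq₁
  rw [lt_div_iff₀ hCD] at hk
  have hcontr : ContractingWith (1 / 2) T^[k] := by
    refine ⟨by norm_num, LipschitzWith.of_dist_le_mul fun x y => ?_⟩
    rw [dist_eq_norm, dist_eq_norm]
    refine le_of_sq_le_sq ?_ (by positivity)
    calc ‖T^[k] x - T^[k] y‖ ^ 2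
        ≤ C * V (T^[k] x - T^[k] y) := hnorm_le _
      _ ≤ C * (q ^ k * V (x - y)) := by gcongr; exact iterate_sub_le hq₀ hT k x y
      _ ≤ C * (q ^ k * (D * ‖x - y‖ ^ 2)) := by gcongr; exact hle_norm _
      _ = q ^ k * (C * D) * ‖x - y‖ ^ 2 := by ring
      _ ≤ (1 / 2) ^ 2 * ‖x - y‖ ^ 2 := by gcongr
      _ = _ := by simp [mul_pow]
  exact ⟨_, hcontr.isFixedPt_fixedPoint_iterate⟩

lemma tendsto_iterate (hV : IsQuadraticGauge V) (hq₀ : 0 ≤ q) (hq₁ : q < 1)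
    (hT : ∀ x y, V (T x - T y) ≤ q * V (x - y)) {x : E} (hx : IsFixedPt T x) (z : E) :
    Tendsto (fun k => T^[k] z) atTop (𝓝 x) := by
  rw [← tendsto_sub_nhds_zero_iff]
  refine hV.tendsto_zero (squeeze_zero (fun k => hV.nonneg _) (fun k => ?_)
    (show Tendsto (fun k => q ^ k * V (z - x)) atTop (𝓝 0) by
      simpa using (tendsto_pow_atTop_nhds_zero_of_lt_one hq₀ hq₁).mul_const (V (z - x))))
  simpa only [(hx.iterate k).eq] using iterate_sub_le hq₀ hT k z x

end Contraction

end IsQuadraticGauge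

end QuadraticGauge

section Matrix

open Matrix

variable {ι κ : Type*} [Fintype ι] [Fintype κ]

lemma exists_mulVec_eq_of_forall_vecMul_eq_zero {K : Type*} [Field K]
    (M : Matrix ι κ K) (r : ι → K) (h : ∀ v, v ᵥ* M = 0 → v ⬝ᵥ r = 0) : ∃ x, M *ᵥ x = r := by
  classical
  by_contra hr
  obtain ⟨φ, hφr, hφ⟩ := Submodule.exists_le_ker_of_notMem (p := M.mulVecLin.range) hr
  obtain ⟨v, rfl⟩ := (dotProductEquiv K ι).surjective φ
  refine hφr (h v (dotProduct_eq_zero _ fun w => ?_))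
  rw [← dotProduct_mulVec]
  exact hφ ⟨w, rfl⟩

lemma mulVec_surjective_of_linearIndependent_row {K α : Type*} [Field K] [Finite α]
    {M : Matrix α κ K} (h : LinearIndependent K M.row) : Surjective M.mulVec := by
  have := Fintype.ofFinite α
  refine fun r => exists_mulVec_eq_of_forall_vecMul_eq_zero M r fun v hv => ?_
  rw [vecMul_injective_iff.2 h (hv.trans (zero_vecMul M).symm), zero_dotProduct]

lemma dotProduct_mulVec_comm {R : Type*} [CommSemiring R] {M : Matrix ι ι R} (hM : M.IsSymm)
    (x y : ι → R) : x ⬝ᵥ (M *ᵥ y) = y ⬝ᵥ (M *ᵥ x) := by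
  rw [← dotProduct_transpose_mulVec, hM.eq]

lemma isSymm_of_posDef {α : Type*} {M : Matrix α α ℝ} (hM : M.PosDef) : M.IsSymm := by
  rw [IsSymm, ← conjTranspose_eq_transpose_of_trivial]
  exact hM.isHermitian

lemma isQuadraticGauge_dotProduct_mulVec {M : Matrix ι ι ℝ} (hM : ∀ x ≠ 0, 0 < x ⬝ᵥ (M *ᵥ x)) :
    IsQuadraticGauge fun x => x ⬝ᵥ (M *ᵥ x) where
  continuous := by fun_prop
  map_smul t x := by
    simp only [mulVec_smul, dotProduct_smul, smul_dotProduct, smul_eq_mul]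
    ring
  pos := hM

lemma isUnit_of_dotProduct_mulVec_pos [DecidableEq ι] {M : Matrix ι ι ℝ}
    (hM : ∀ x ≠ 0, 0 < x ⬝ᵥ (M *ᵥ x)) : IsUnit M := by
  refine mulVec_injective_iff_isUnit.1 fun x y hxy => ?_
  by_contra hne
  have := hM _ (sub_ne_zero.2 hne)
  simp [mulVec_sub, hxy] at this

lemma exists_fromBlocks_mulVec_eq {M : Matrix ι ι ℝ} (hM : ∀ x ≠ 0, 0 < x ⬝ᵥ (M *ᵥ x))
    (B : Matrix κ ι ℝ) (c y : ι → ℝ) :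
    ∃ w, fromBlocks M Bᵀ B 0 *ᵥ w = Sum.elim c (B *ᵥ y) := by
  refine exists_mulVec_eq_of_forall_vecMul_eq_zero _ _ fun v hv => ?_
  obtain ⟨u, w, rfl⟩ : ∃ u w, v = Sum.elim u w := ⟨_, _, (Sum.elim_comp_inl_inr v).symm⟩
  simp only [vecMul_fromBlocks, Sum.elim_comp_inl, Sum.elim_comp_inr, vecMul_zero, add_zero,
    vecMul_transpose, ← Sum.elim_zero_zero, Sum.elim_eq_iff] at hv
  obtain ⟨hu, hBu⟩ := hv
  have hu₀ : u = 0 := by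
    refine (isQuadraticGauge_dotProduct_mulVec hM).eq_zero_of_nonpos (le_of_eq ?_)
    simpa [add_dotProduct, ← dotProduct_mulVec, hBu] using congrArg (· ⬝ᵥ u) hu
  rw [hu₀, zero_vecMul, zero_add] at hu
  rw [sumElim_dotProduct_sumElim, hu₀, zero_dotProduct, zero_add, dotProduct_mulVec, hu,
    zero_dotProduct]

lemma dotProduct_inv_mulVec_add {K : Type*} [Field K] [DecidableEq ι] {M : Matrix ι ι K}
    (hM : M.IsSymm) (hu : IsUnit M) (r w : ι → K) :
    (r + M *ᵥ w) ⬝ᵥ (M⁻¹ *ᵥ (r + M *ᵥ w)) =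
      r ⬝ᵥ (M⁻¹ *ᵥ r) + 2 * (w ⬝ᵥ r) + w ⬝ᵥ (M *ᵥ w) := by
  obtain ⟨p, rfl⟩ := mulVec_surjective_iff_isUnit.2 hu r
  have hinv (v) : M⁻¹ *ᵥ (M *ᵥ v) = v := by
    rw [mulVec_mulVec, nonsing_inv_mul _ ((isUnit_iff_isUnit_det M).1 hu), one_mulVec]
  rw [← mulVec_add, hinv, hinv, dotProduct_comm, dotProduct_comm _ p]
  simp only [mulVec_add, add_dotProduct, dotProduct_add, dotProduct_mulVec_comm hM w p]
  ring

/-- The quadratic function with Hessian `M` and linear term `c`. -/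
noncomputable def quadratic (M : Matrix ι ι ℝ) (c x : ι → ℝ) : ℝ :=
  1 / 2 * (x ⬝ᵥ (M *ᵥ x)) + c ⬝ᵥ x

variable {M : Matrix ι ι ℝ} {c : ι → ℝ} {s : Set (ι → ℝ)}

lemma quadratic_add (hM : M.IsSymm) (y d : ι → ℝ) :
    quadratic M c (y + d) = quadratic M c y + (M *ᵥ y + c) ⬝ᵥ d + 1 / 2 * (d ⬝ᵥ (M *ᵥ d)) := by
  simp only [quadratic, mulVec_add, dotProduct_add, add_dotProduct, dotProduct_mulVec_comm hM y d,
    dotProduct_comm (M *ᵥ y) d]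
  ring

lemma exists_isMinOn_quadratic (hM : M.PosDef) (hs : IsClosed s) (hne : s.Nonempty) :
    ∃ y ∈ s, IsMinOn (quadratic M c) s y := by
  classical
  obtain ⟨u, hu⟩ := mulVec_surjective_iff_isUnit.2 hM.isUnit (-c)
  have hcont : Continuous (quadratic M c) := by unfold quadratic; fun_prop
  have hsq (x) : quadratic M c x = quadratic M c u + 1 / 2 * ((x - u) ⬝ᵥ (M *ᵥ (x - u))) := by
    conv_lhs => rw [← add_sub_cancel u x, quadratic_add (isSymm_of_posDef hM), hu]
    simp
  have hlim : Tendsto (quadratic M c) (cocompact _) atTop := by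
    have hgauge := isQuadraticGauge_dotProduct_mulVec fun x hx => hM.dotProduct_mulVec_pos hx
    refine Tendsto.congr (fun x => (hsq x).symm) ?_
    exact tendsto_atTop_add_const_left _ _ ((hgauge.tendsto_cocompact_atTop.comp
      (Homeomorph.subRight u).isClosedEmbedding.tendsto_cocompact).const_mul_atTop one_half_pos)
  obtain ⟨x₀, hx₀⟩ := hne
  exact hcont.continuousOn.exists_isMinOn' hs hx₀
    ((hlim.eventually_ge_atTop _).filter_mono inf_le_left)

lemma dotProduct_sub_nonneg_of_isMinOn_quadratic (hM : M.IsSymm) (hs : Convex ℝ s) {x y : ι → ℝ}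
    (hy : y ∈ s) (hmin : IsMinOn (quadratic M c) s y) (hx : x ∈ s) :
    0 ≤ (M *ᵥ y + c) ⬝ᵥ (x - y) := by
  set g := (M *ᵥ y + c) ⬝ᵥ (x - y)
  set a := 1 / 2 * ((x - y) ⬝ᵥ (M *ᵥ (x - y)))
  have hslope : ∀ᶠ t : ℝ in 𝓝[>] 0, 0 ≤ g + t * a := by
    filter_upwards [Ioc_mem_nhdsGT one_pos] with t ht
    have hle : quadratic M c y ≤ quadratic M c (y + t • (x - y)) :=
      hmin (hs.add_smul_sub_mem hy hx ⟨ht.1.le, ht.2⟩)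
    have hexpand : quadratic M c (y + t • (x - y)) = quadratic M c y + t * (g + t * a) := by
      simp only [quadratic_add hM, mulVec_smul, dotProduct_smul, smul_dotProduct, smul_eq_mul, g, a]
      ring
    exact nonneg_of_mul_nonneg_right (by linarith) ht.1
  have hlim : Tendsto (fun t : ℝ => g + t * a) (𝓝[>] 0) (𝓝 g) :=
    tendsto_nhdsWithin_of_tendsto_nhds
      ((by fun_prop : Continuous fun t : ℝ => g + t * a).tendsto' 0 g (by simp))
  exact ge_of_tendsto hlim hslope

end Matrix

namespace AVI

open Matrix

variable {n m : ℕ} {P : AVI n m} {ρ : ℝ}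

section PositiveDefinite

lemma isSymm_Hs : P.Hs.IsSymm := by
  simp [Matrix.IsSymm, Hs, add_comm]

lemma dotProduct_Hs (x : Fin n → ℝ) : x ⬝ᵥ (P.Hs *ᵥ x) = x ⬝ᵥ (P.H *ᵥ x) := by
  simp only [Hs, smul_mulVec, add_mulVec, dotProduct_smul, dotProduct_add, smul_eq_mul,
    dotProduct_transpose_mulVec]
  ring

lemma posDef_Hs (hH : (P.H + P.Hᵀ).PosDef) : P.Hs.PosDef :=
  hH.smul one_half_pos

lemma isQuadraticGauge_H (hH : (P.H + P.Hᵀ).PosDef) :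
    IsQuadraticGauge fun x => x ⬝ᵥ (P.H *ᵥ x) :=
  isQuadraticGauge_dotProduct_mulVec fun x hx => by
    simpa only [star_trivial, dotProduct_Hs] using (posDef_Hs hH).dotProduct_mulVec_pos hx

lemma posDef_Ht (hρ : 0 < ρ) (hH : (P.H + P.Hᵀ).PosDef) : (P.Ht ρ).PosDef :=
  (PosDef.one.smul hρ).add (posDef_Hs hH)

lemma isUnit_smul_one_add_H (hρ : 0 < ρ) (hH : (P.H + P.Hᵀ).PosDef) : IsUnit (ρ • 1 + P.H) :=
  isUnit_of_dotProduct_mulVec_pos fun x hx => by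
    have hpos := (posDef_Ht hρ hH).dotProduct_mulVec_pos hx
    simpa only [Ht, star_trivial, add_mulVec, dotProduct_add, dotProduct_Hs] using hpos

end PositiveDefinite

section Stationary

lemma convex_feasible : Convex ℝ P.feasible :=
  (convex_Iic P.b).linear_preimage P.A.mulVecLin

lemma isClosed_feasible : IsClosed P.feasible :=
  isClosed_le (by fun_prop) continuous_const

/-- `-g` lies in the normal cone of the feasible polyhedron at `x`. This is the optimality condition
shared by the variational inequality, where `g = H x + f`, and the quadratic programs. -/
def IsStationary (P : AVI n m) (g x : Fin n → ℝ) : Prop :=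
  x ∈ P.feasible ∧ ∀ y ∈ P.feasible, 0 ≤ g ⬝ᵥ (y - x)

lemma IsStationary.sub_dotProduct_sub_nonpos {g₁ g₂ x₁ x₂ : Fin n → ℝ}
    (h₁ : P.IsStationary g₁ x₁) (h₂ : P.IsStationary g₂ x₂) : (x₁ - x₂) ⬝ᵥ (g₁ - g₂) ≤ 0 := by
  have h₁₂ := h₁.2 x₂ h₂.1
  have h₂₁ := h₂.2 x₁ h₁.1
  rw [dotProduct_comm]
  simp only [sub_dotProduct, dotProduct_sub] at h₁₂ h₂₁ ⊢
  linarith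

lemma IsSolution.unique (hH : (P.H + P.Hᵀ).PosDef) {x y : Fin n → ℝ} (hx : P.IsSolution x)
    (hy : P.IsSolution y) : x = y := by
  refine sub_eq_zero.1 ((isQuadraticGauge_H hH).eq_zero_of_nonpos ?_)
  simpa [mulVec_sub] using IsStationary.sub_dotProduct_sub_nonpos hx hy

end Stationary

section QuadraticProgram

lemma exists_isQPSolution (hρ : 0 < ρ) (hX : P.feasible.Nonempty) (hH : (P.H + P.Hᵀ).PosDef)
    (z : Fin n → ℝ) : ∃ y, P.IsQPSolution ρ z y :=
  exists_isMinOn_quadratic (posDef_Ht hρ hH) isClosed_feasible hX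

lemma IsQPSolution.isStationary (hρ : 0 < ρ) (hH : (P.H + P.Hᵀ).PosDef) {z y : Fin n → ℝ}
    (h : P.IsQPSolution ρ z y) : P.IsStationary (P.Ht ρ *ᵥ y + P.ft ρ z) y :=
  ⟨h.1, fun _ hx => dotProduct_sub_nonneg_of_isMinOn_quadratic
    (isSymm_of_posDef (posDef_Ht hρ hH)) convex_feasible h.1 h.2 hx⟩

lemma dotProduct_Ht_add_nonpos {z₁ z₂ y₁ y₂ : Fin n → ℝ}
    (h₁ : P.IsStationary (P.Ht ρ *ᵥ y₁ + P.ft ρ z₁) y₁)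
    (h₂ : P.IsStationary (P.Ht ρ *ᵥ y₂ + P.ft ρ z₂) y₂) :
    (y₁ - y₂) ⬝ᵥ (P.Ht ρ *ᵥ (y₁ - y₂) + (P.H - P.Ht ρ) *ᵥ (z₁ - z₂)) ≤ 0 := by
  convert h₁.sub_dotProduct_sub_nonpos h₂ using 2
  simp only [ft, mulVec_sub]
  abel

lemma eq_of_isStationary_Ht (hρ : 0 < ρ) (hH : (P.H + P.Hᵀ).PosDef) {z y₁ y₂ : Fin n → ℝ}
    (h₁ : P.IsStationary (P.Ht ρ *ᵥ y₁ + P.ft ρ z) y₁)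
    (h₂ : P.IsStationary (P.Ht ρ *ᵥ y₂ + P.ft ρ z) y₂) : y₁ = y₂ := by
  have hgauge := isQuadraticGauge_dotProduct_mulVec
    fun x hx => (posDef_Ht hρ hH).dotProduct_mulVec_pos hx
  refine sub_eq_zero.1 (hgauge.eq_zero_of_nonpos ?_)
  simpa using dotProduct_Ht_add_nonpos h₁ h₂

/-- The solution of the quadratic program with parameter `z`; arbitrary if there is none. -/
noncomputable def qpSol (P : AVI n m) (ρ : ℝ) (z : Fin n → ℝ) : Fin n → ℝ :=
  Classical.epsilon (P.IsQPSolution ρ z)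

lemma isQPSolution_qpSol (hρ : 0 < ρ) (hX : P.feasible.Nonempty) (hH : (P.H + P.Hᵀ).PosDef)
    (z : Fin n → ℝ) : P.IsQPSolution ρ z (P.qpSol ρ z) :=
  Classical.epsilon_spec (exists_isQPSolution hρ hX hH z)

lemma isStationary_qpSol (hρ : 0 < ρ) (hX : P.feasible.Nonempty) (hH : (P.H + P.Hᵀ).PosDef)
    (z : Fin n → ℝ) : P.IsStationary (P.Ht ρ *ᵥ P.qpSol ρ z + P.ft ρ z) (P.qpSol ρ z) :=
  (isQPSolution_qpSol hρ hX hH z).isStationary hρ hH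

lemma IsQPSolution.eq_qpSol (hρ : 0 < ρ) (hX : P.feasible.Nonempty) (hH : (P.H + P.Hᵀ).PosDef)
    {z y : Fin n → ℝ} (h : P.IsQPSolution ρ z y) : y = P.qpSol ρ z :=
  eq_of_isStationary_Ht hρ hH (h.isStationary hρ hH) (isStationary_qpSol hρ hX hH z)

lemma Ht_mulVec_add_ft (x : Fin n → ℝ) : P.Ht ρ *ᵥ x + P.ft ρ x = P.H *ᵥ x + P.f := by
  simp only [ft, sub_mulVec]
  abel

lemma qpSol_eq_self_iff (hρ : 0 < ρ) (hX : P.feasible.Nonempty) (hH : (P.H + P.Hᵀ).PosDef)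
    {x : Fin n → ℝ} : P.qpSol ρ x = x ↔ P.IsSolution x := by
  have hst := isStationary_qpSol hρ hX hH x
  refine ⟨fun h => ?_, fun hx => eq_of_isStationary_Ht hρ hH hst ?_⟩
  · rwa [h, Ht_mulVec_add_ft] at hst
  · rwa [Ht_mulVec_add_ft]

end QuadraticProgram

section DouglasRachford

/-- The matrix `ρ I + H_s / 2`: the Douglas-Rachford update satisfies
`(ρ I + H) (z⁺ - z) = (ρ I + H_s / 2) (y - z)`. -/
noncomputable def drMetric (P : AVI n m) (ρ : ℝ) : Matrix (Fin n) (Fin n) ℝ :=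
  ρ • 1 + (1 / 2 : ℝ) • P.Hs

lemma posDef_drMetric (hρ : 0 < ρ) (hH : (P.H + P.Hᵀ).PosDef) : (P.drMetric ρ).PosDef :=
  (PosDef.one.smul hρ).add ((posDef_Hs hH).smul one_half_pos)

lemma mulVec_drUpdate (hρ : 0 < ρ) (hH : (P.H + P.Hᵀ).PosDef) (z y : Fin n → ℝ) :
    (ρ • 1 + P.H) *ᵥ P.drUpdate ρ z y = (ρ • 1 + P.H) *ᵥ z + P.drMetric ρ *ᵥ (y - z) := by
  have hdet := (isUnit_iff_isUnit_det _).1 (isUnit_smul_one_add_H hρ hH)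
  rw [drUpdate, mulVec_mulVec, mul_nonsing_inv _ hdet, one_mulVec]
  simp only [drMetric, add_mulVec, smul_mulVec, one_mulVec, smul_sub]
  abel

lemma drUpdate_eq_self_iff (hρ : 0 < ρ) (hH : (P.H + P.Hᵀ).PosDef) {z y : Fin n → ℝ} :
    P.drUpdate ρ z y = z ↔ y = z := by
  have hR := mulVec_injective_of_isUnit (isUnit_smul_one_add_H hρ hH)
  have hM := mulVec_injective_of_isUnit (posDef_drMetric hρ hH).isUnit
  rw [← hR.eq_iff, mulVec_drUpdate hρ hH, add_eq_left, ← mulVec_zero (P.drMetric ρ), hM.eq_iff,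
    sub_eq_zero]

/-- The squared norm of `(ρ I + H) v` in the metric dual to `drMetric`, which is the Lyapunov
function of the Douglas-Rachford iteration. -/
noncomputable def drEnergy (P : AVI n m) (ρ : ℝ) (v : Fin n → ℝ) : ℝ :=
  ((ρ • 1 + P.H) *ᵥ v) ⬝ᵥ ((P.drMetric ρ)⁻¹ *ᵥ ((ρ • 1 + P.H) *ᵥ v))

lemma isQuadraticGauge_drEnergy (hρ : 0 < ρ) (hH : (P.H + P.Hᵀ).PosDef) :
    IsQuadraticGauge (P.drEnergy ρ) :=
  (isQuadraticGauge_dotProduct_mulVec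
    fun _ hx => (posDef_drMetric hρ hH).inv.dotProduct_mulVec_pos hx).comp_injective
    (ρ • 1 + P.H).mulVecLin.toContinuousLinearMap
    (mulVec_injective_of_isUnit (isUnit_smul_one_add_H hρ hH))

lemma drEnergy_add_eq (hρ : 0 < ρ) (hH : (P.H + P.Hᵀ).PosDef) {e e' d : Fin n → ℝ}
    (h : (ρ • 1 + P.H) *ᵥ e' = (ρ • 1 + P.H) *ᵥ e + P.drMetric ρ *ᵥ (d - e)) :
    P.drEnergy ρ e' + e ⬝ᵥ (P.H *ᵥ e) + d ⬝ᵥ (P.H *ᵥ d) + (d - e) ⬝ᵥ (P.drMetric ρ *ᵥ (d - e)) =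
      P.drEnergy ρ e + 2 * (d ⬝ᵥ (P.Ht ρ *ᵥ d + (P.H - P.Ht ρ) *ᵥ e)) := by
  have hM := posDef_drMetric hρ hH
  rw [drEnergy, h, dotProduct_inv_mulVec_add (isSymm_of_posDef hM) hM.isUnit, ← drEnergy]
  simp only [drMetric, Ht, add_mulVec, sub_mulVec, smul_mulVec, one_mulVec, mulVec_sub,
    dotProduct_add, dotProduct_sub, sub_dotProduct, dotProduct_smul, smul_eq_mul, dotProduct_Hs,
    dotProduct_mulVec_comm isSymm_Hs e d, dotProduct_comm e d]
  ring

/-- One step of the plain Douglas-Rachford iteration. -/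
noncomputable def drMap (P : AVI n m) (ρ : ℝ) (z : Fin n → ℝ) : Fin n → ℝ :=
  P.drUpdate ρ z (P.qpSol ρ z)

lemma isFixedPt_drMap_iff (hρ : 0 < ρ) (hX : P.feasible.Nonempty) (hH : (P.H + P.Hᵀ).PosDef)
    {x : Fin n → ℝ} : IsFixedPt (P.drMap ρ) x ↔ P.IsSolution x := by
  rw [IsFixedPt, drMap, drUpdate_eq_self_iff hρ hH, qpSol_eq_self_iff hρ hX hH]

lemma drEnergy_drMap_sub_add_le (hρ : 0 < ρ) (hX : P.feasible.Nonempty)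
    (hH : (P.H + P.Hᵀ).PosDef) (z₁ z₂ : Fin n → ℝ) :
    P.drEnergy ρ (P.drMap ρ z₁ - P.drMap ρ z₂) + (z₁ - z₂) ⬝ᵥ (P.H *ᵥ (z₁ - z₂)) +
      (P.qpSol ρ z₁ - P.qpSol ρ z₂) ⬝ᵥ (P.H *ᵥ (P.qpSol ρ z₁ - P.qpSol ρ z₂)) ≤
    P.drEnergy ρ (z₁ - z₂) := by
  set d := P.qpSol ρ z₁ - P.qpSol ρ z₂
  have hmono : d ⬝ᵥ (P.Ht ρ *ᵥ d + (P.H - P.Ht ρ) *ᵥ (z₁ - z₂)) ≤ 0 :=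
    dotProduct_Ht_add_nonpos (isStationary_qpSol hρ hX hH z₁) (isStationary_qpSol hρ hX hH z₂)
  have hupdate : (ρ • 1 + P.H) *ᵥ (P.drMap ρ z₁ - P.drMap ρ z₂) =
      (ρ • 1 + P.H) *ᵥ (z₁ - z₂) + P.drMetric ρ *ᵥ (d - (z₁ - z₂)) := by
    simp only [d, drMap, mulVec_sub, mulVec_drUpdate hρ hH]
    abel
  have hsq := (posDef_drMetric hρ hH).posSemidef.dotProduct_mulVec_nonneg (d - (z₁ - z₂))
  rw [star_trivial] at hsq
  linarith [drEnergy_add_eq hρ hH hupdate]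

lemma exists_drEnergy_drMap_sub_le (hρ : 0 < ρ) (hX : P.feasible.Nonempty)
    (hH : (P.H + P.Hᵀ).PosDef) : ∃ q : ℝ, 0 ≤ q ∧ q < 1 ∧
      ∀ z₁ z₂, P.drEnergy ρ (P.drMap ρ z₁ - P.drMap ρ z₂) ≤ q * P.drEnergy ρ (z₁ - z₂) := by
  have hgauge := isQuadraticGauge_H hH
  obtain ⟨C, hC, hle⟩ := (isQuadraticGauge_drEnergy hρ hH).exists_le_mul hgauge
  have hC₀ : 0 < C := by positivity
  refine ⟨1 - C⁻¹, sub_nonneg.2 (inv_le_one_of_one_le₀ hC), sub_lt_self _ (inv_pos.2 hC₀), ?_⟩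
  intro z₁ z₂
  have hdecrease := drEnergy_drMap_sub_add_le hρ hX hH z₁ z₂
  have hsmall := (inv_mul_le_iff₀ hC₀).2 (hle (z₁ - z₂))
  have hnonneg := hgauge.nonneg (P.qpSol ρ z₁ - P.qpSol ρ z₂)
  linarith

lemma continuous_qpSol (hρ : 0 < ρ) (hX : P.feasible.Nonempty) (hH : (P.H + P.Hᵀ).PosDef) :
    Continuous (P.qpSol ρ) := by
  have hgauge := isQuadraticGauge_H hH
  have henergy := isQuadraticGauge_drEnergy hρ hH
  refine hgauge.continuous_of_le henergy fun z₁ z₂ => ?_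
  have hdecrease := drEnergy_drMap_sub_add_le hρ hX hH z₁ z₂
  have hnonneg := hgauge.nonneg (z₁ - z₂)
  linarith [henergy.nonneg (P.drMap ρ z₁ - P.drMap ρ z₂)]

lemma exists_isSolution (hX : P.feasible.Nonempty) (hH : (P.H + P.Hᵀ).PosDef) :
    ∃ x, P.IsSolution x := by
  obtain ⟨q, hq₀, hq₁, hq⟩ := exists_drEnergy_drMap_sub_le one_pos hX hH
  obtain ⟨x, hx⟩ := (isQuadraticGauge_drEnergy one_pos hH).exists_isFixedPt hq₀ hq₁ hq
  exact ⟨x, (isFixedPt_drMap_iff one_pos hX hH).1 hx⟩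

lemma IsSolution.tendsto_iterate_drMap (hρ : 0 < ρ) (hX : P.feasible.Nonempty)
    (hH : (P.H + P.Hᵀ).PosDef) {x : Fin n → ℝ} (hx : P.IsSolution x) (z : Fin n → ℝ) :
    Tendsto (fun k => (P.drMap ρ)^[k] z) atTop (𝓝 x) := by
  obtain ⟨q, hq₀, hq₁, hq⟩ := exists_drEnergy_drMap_sub_le hρ hX hH
  exact (isQuadraticGauge_drEnergy hρ hH).tendsto_iterate hq₀ hq₁ hq
    ((isFixedPt_drMap_iff hρ hX hH).2 hx) z

end DouglasRachford

section KKT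

lemma mem_activeSet {x : Fin n → ℝ} {i : Fin m} :
    i ∈ P.activeSet x ↔ (P.A *ᵥ x) i = P.b i := by
  simp [activeSet]

lemma lt_of_notMem_activeSet {x : Fin n → ℝ} (hx : x ∈ P.feasible) {i : Fin m}
    (hi : i ∉ P.activeSet x) : (P.A *ᵥ x) i < P.b i :=
  (hx i).lt_of_ne (mem_activeSet.not.1 hi)

lemma rows_mulVec_apply (S : Finset (Fin m)) (x : Fin n → ℝ) (i : S) :
    (P.rows S *ᵥ x) i = (P.A *ᵥ x) i := rfl

lemma transpose_rows_mulVec (S : Finset (Fin m)) (μ : S → ℝ) :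
    (P.rows S)ᵀ *ᵥ μ = P.Aᵀ *ᵥ extendZero S μ := by
  ext j
  simp only [mulVec, dotProduct, transpose_apply, rows, submatrix_apply, id, extendZero]
  rw [← Finset.sum_subset (Finset.subset_univ S) (fun i _ hi => by simp [hi]),
    ← Finset.sum_coe_sort S]
  exact Finset.sum_congr rfl fun i _ => by simp

lemma extendZero_restrict {S : Finset (Fin m)} {l : Fin m → ℝ} (h : ∀ i ∉ S, l i = 0) :
    extendZero S (fun i : S => l i) = l := by
  ext i
  by_cases hi : i ∈ S
  · simp [extendZero, hi]
  · simp [extendZero, hi, h i hi]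

lemma LICQ.transpose_rows_mulVec_injective {x : Fin n → ℝ} (hL : P.LICQ x) :
    Injective (P.rows (P.activeSet x))ᵀ.mulVec := by
  rw [funext (mulVec_transpose _)]
  exact vecMul_injective_iff.2 hL

lemma LICQ.exists_rows_mulVec_eq_single {x g : Fin n → ℝ} {μ : P.activeSet x → ℝ}
    (hL : P.LICQ x) (hg : g + (P.rows (P.activeSet x))ᵀ *ᵥ μ = 0) (j : P.activeSet x) :
    ∃ d, P.rows (P.activeSet x) *ᵥ d = Pi.single j 1 ∧ g ⬝ᵥ d = -μ j := by
  obtain ⟨d, hd⟩ := mulVec_surjective_of_linearIndependent_row (M := P.rows (P.activeSet x)) hL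
    (Pi.single j 1)
  refine ⟨d, hd, ?_⟩
  rw [eq_neg_of_add_eq_zero_left hg, neg_dotProduct, mulVec_transpose, ← dotProduct_mulVec, hd,
    dotProduct_single_one]

lemma eventually_add_smul_mem_feasible {x d : Fin n → ℝ} (hx : x ∈ P.feasible)
    (hd : ∀ i ∈ P.activeSet x, (P.A *ᵥ d) i ≤ 0) : ∀ᶠ ε : ℝ in 𝓝[>] 0, x + ε • d ∈ P.feasible := by
  have hrow (i : Fin m) : ∀ᶠ ε : ℝ in 𝓝[>] 0, (P.A *ᵥ x) i + ε * (P.A *ᵥ d) i ≤ P.b i := by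
    by_cases hi : i ∈ P.activeSet x
    · filter_upwards [self_mem_nhdsWithin] with ε hε
      rw [mem_activeSet.1 hi]
      exact add_le_of_nonpos_right (mul_nonpos_of_nonneg_of_nonpos (le_of_lt hε) (hd i hi))
    · have hcont : Continuous fun ε : ℝ => (P.A *ᵥ x) i + ε * (P.A *ᵥ d) i := by fun_prop
      have hlim := hcont.tendsto' 0 ((P.A *ᵥ x) i) (by simp)
      exact ((hlim.eventually_lt_const (lt_of_notMem_activeSet hx hi)).filter_mono
        nhdsWithin_le_nhds).mono fun _ => le_of_lt
  filter_upwards [eventually_all.2 hrow] with ε hε i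
  simpa [mulVec_add, mulVec_smul] using hε i

lemma IsStationary.dotProduct_nonneg {g x d : Fin n → ℝ} (h : P.IsStationary g x)
    (hd : ∀ i ∈ P.activeSet x, (P.A *ᵥ d) i ≤ 0) : 0 ≤ g ⬝ᵥ d := by
  obtain ⟨ε, hmem, hε⟩ :=
    ((eventually_add_smul_mem_feasible h.1 hd).and self_mem_nhdsWithin).exists
  have hnonneg := h.2 _ hmem
  rw [add_sub_cancel_left, dotProduct_smul, smul_eq_mul] at hnonneg
  exact nonneg_of_mul_nonneg_right hnonneg hε

lemma IsStationary.exists_multiplier {g x : Fin n → ℝ} (h : P.IsStationary g x) :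
    ∃ μ : P.activeSet x → ℝ, g + (P.rows (P.activeSet x))ᵀ *ᵥ μ = 0 := by
  obtain ⟨μ, hμ⟩ := exists_mulVec_eq_of_forall_vecMul_eq_zero (P.rows (P.activeSet x))ᵀ (-g)
    fun d hd => by
      rw [vecMul_transpose] at hd
      have hAd : ∀ i ∈ P.activeSet x, (P.A *ᵥ d) i = 0 := fun i hi => congrFun hd ⟨i, hi⟩
      have hpos : 0 ≤ g ⬝ᵥ d := h.dotProduct_nonneg fun i hi => (hAd i hi).le
      have hneg : 0 ≤ g ⬝ᵥ (-d) := h.dotProduct_nonneg fun i hi => by simp [mulVec_neg, hAd i hi]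
      rw [dotProduct_neg] at hneg
      rw [dotProduct_comm, neg_dotProduct]
      linarith
  exact ⟨μ, by rw [hμ, add_neg_cancel]⟩

lemma IsStationary.multiplier_nonneg {g x : Fin n → ℝ} {μ : P.activeSet x → ℝ}
    (h : P.IsStationary g x) (hL : P.LICQ x) (hg : g + (P.rows (P.activeSet x))ᵀ *ᵥ μ = 0) :
    0 ≤ μ := by
  intro j
  obtain ⟨d, hd, hgd⟩ := hL.exists_rows_mulVec_eq_single hg j
  have hneg : 0 ≤ g ⬝ᵥ (-d) := h.dotProduct_nonneg fun i hi => by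
    rw [mulVec_neg, Pi.neg_apply, ← rows_mulVec_apply _ d ⟨i, hi⟩, hd, neg_nonpos]
    exact (Pi.single_nonneg.2 zero_le_one : (0 : P.activeSet x → ℝ) ≤ Pi.single j 1) _
  simpa [hgd] using hneg

lemma solvesKKTSystem_iff {S : Finset (Fin m)} {x : Fin n → ℝ} {μ : S → ℝ} :
    P.SolvesKKTSystem S x μ ↔
      P.H *ᵥ x + P.f + (P.rows S)ᵀ *ᵥ μ = 0 ∧ P.rows S *ᵥ x = fun i : S => P.b i := by
  rw [SolvesKKTSystem, fromBlocks_mulVec, Sum.elim_eq_iff, add_right_comm,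
    ← eq_neg_iff_add_eq_zero]
  simp

lemma exists_solvesKKTSystem_activeSet (hH : (P.H + P.Hᵀ).PosDef) (y : Fin n → ℝ) :
    ∃ x μ, P.SolvesKKTSystem (P.activeSet y) x μ := by
  obtain ⟨w, hw⟩ :=
    exists_fromBlocks_mulVec_eq (isQuadraticGauge_H hH).pos (P.rows (P.activeSet y)) (-P.f) y
  have hb : P.rows (P.activeSet y) *ᵥ y = fun i : P.activeSet y => P.b i :=
    funext fun i => mem_activeSet.1 i.2
  exact ⟨w ∘ Sum.inl, w ∘ Sum.inr, by rw [SolvesKKTSystem, Sum.elim_comp_inl_inr, hw, hb]⟩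

lemma SolvesKKTSystem.unique (hH : (P.H + P.Hᵀ).PosDef) {S : Finset (Fin m)}
    {x x' : Fin n → ℝ} {μ μ' : S → ℝ} (h : P.SolvesKKTSystem S x μ)
    (h' : P.SolvesKKTSystem S x' μ') : x = x' := by
  rw [solvesKKTSystem_iff] at h h'
  refine sub_eq_zero.1 ((isQuadraticGauge_H hH).eq_zero_of_nonpos (le_of_eq ?_))
  have hrows : P.rows S *ᵥ (x - x') = 0 := by rw [mulVec_sub, h.2, h'.2, sub_self]
  have hgrad : P.H *ᵥ (x - x') = (P.rows S)ᵀ *ᵥ (μ' - μ) := by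
    simp only [mulVec_sub]
    linear_combination h.1 - h'.1
  rw [hgrad, dotProduct_transpose_mulVec, hrows, dotProduct_zero]

lemma SolvesKKTSystem.isKKT {S : Finset (Fin m)} {x : Fin n → ℝ} {μ : S → ℝ}
    (h : P.SolvesKKTSystem S x μ) (hμ : 0 ≤ μ) (hx : x ∈ P.feasible) :
    P.IsKKT x (extendZero S μ) := by
  obtain ⟨hgrad, hrows⟩ := solvesKKTSystem_iff.1 h
  refine ⟨by rwa [← transpose_rows_mulVec], fun i => ?_, sub_nonneg.2 hx, ?_⟩
  · by_cases hi : i ∈ S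
    · simpa [extendZero, hi] using hμ ⟨i, hi⟩
    · simp [extendZero, hi]
  · refine Finset.sum_eq_zero fun i _ => ?_
    by_cases hi : i ∈ S
    · simp [← rows_mulVec_apply S x ⟨i, hi⟩, hrows]
    · simp [extendZero, hi]

lemma IsSolution.exists_isKKT {x : Fin n → ℝ} (hx : P.IsSolution x) (hL : P.LICQ x) :
    ∃ l, P.IsKKT x l := by
  obtain ⟨μ, hμ⟩ := IsStationary.exists_multiplier hx
  have hsys : P.SolvesKKTSystem (P.activeSet x) x μ :=
    solvesKKTSystem_iff.2 ⟨hμ, funext fun i => mem_activeSet.1 i.2⟩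
  exact ⟨_, hsys.isKKT (IsStationary.multiplier_nonneg hx hL hμ) hx.1⟩

lemma IsKKT.isSolution {x : Fin n → ℝ} {l : Fin m → ℝ} (h : P.IsKKT x l) : P.IsSolution x := by
  obtain ⟨hgrad, hl, hx, hcompl⟩ := h
  refine ⟨sub_nonneg.1 hx, fun y hy => ?_⟩
  have hly : 0 ≤ l ⬝ᵥ (P.b - P.A *ᵥ y) := dotProduct_nonneg_of_nonneg hl (sub_nonneg.2 hy)
  rw [eq_neg_of_add_eq_zero_left hgrad, neg_dotProduct, mulVec_transpose, ← dotProduct_mulVec,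
    mulVec_sub]
  simp only [dotProduct_sub] at hcompl hly ⊢
  linarith

lemma IsKKT.eq_zero_of_notMem {x : Fin n → ℝ} {l : Fin m → ℝ} (h : P.IsKKT x l) {i : Fin m}
    (hi : i ∉ P.activeSet x) : l i = 0 := by
  obtain ⟨-, hl, hx, hcompl⟩ := h
  have hprod := (Finset.sum_eq_zero_iff_of_nonneg fun j _ => mul_nonneg (hl j) (hx j)).1 hcompl i
    (Finset.mem_univ i)
  exact (mul_eq_zero.1 hprod).resolve_right
    (sub_pos.2 (lt_of_notMem_activeSet (sub_nonneg.1 hx) hi)).ne'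

lemma IsKKT.solvesKKTSystem {x : Fin n → ℝ} {l : Fin m → ℝ} (h : P.IsKKT x l) :
    P.SolvesKKTSystem (P.activeSet x) x (fun i => l i) := by
  refine solvesKKTSystem_iff.2 ⟨?_, funext fun i => mem_activeSet.1 i.2⟩
  rw [transpose_rows_mulVec, extendZero_restrict fun i => h.eq_zero_of_notMem]
  exact h.1

lemma IsKKT.eq_of_solvesKKTSystem_activeSet (hH : (P.H + P.Hᵀ).PosDef) {x z : Fin n → ℝ}
    {l : Fin m → ℝ} {μ : P.activeSet x → ℝ} (h : P.IsKKT x l) (hL : P.LICQ x)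
    (hz : P.SolvesKKTSystem (P.activeSet x) z μ) : z = x ∧ μ = fun i : P.activeSet x => l i := by
  obtain rfl := hz.unique hH h.solvesKKTSystem
  exact ⟨rfl, hL.transpose_rows_mulVec_injective (add_left_cancel
    ((solvesKKTSystem_iff.1 hz).1.trans (solvesKKTSystem_iff.1 h.solvesKKTSystem).1.symm))⟩

lemma IsKKT.unique (hH : (P.H + P.Hᵀ).PosDef) {x x' : Fin n → ℝ} {l l' : Fin m → ℝ}
    (h : P.IsKKT x l) (hL : P.LICQ x) (h' : P.IsKKT x' l') : x' = x ∧ l' = l := by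
  obtain rfl := h'.isSolution.unique hH h.isSolution
  have hrestrict := (h.eq_of_solvesKKTSystem_activeSet hH hL h'.solvesKKTSystem).2
  refine ⟨rfl, ?_⟩
  rw [← extendZero_restrict fun i => h'.eq_zero_of_notMem, hrestrict,
    extendZero_restrict fun i => h.eq_zero_of_notMem]

end KKT

section Identification

lemma eventually_activeSet_subset {x : Fin n → ℝ} (hx : x ∈ P.feasible) :
    ∀ᶠ y in 𝓝 x, P.activeSet y ⊆ P.activeSet x := by
  have hinactive (i : Fin m) : ∀ᶠ y in 𝓝 x, i ∈ P.activeSet y → i ∈ P.activeSet x := by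
    by_cases hi : i ∈ P.activeSet x
    · exact .of_forall fun _ _ => hi
    have hcont : Continuous fun y : Fin n → ℝ => (P.A *ᵥ y) i := by fun_prop
    filter_upwards [(hcont.tendsto x).eventually_lt_const (lt_of_notMem_activeSet hx hi)]
      with y hy hiy
    exact absurd (mem_activeSet.1 hiy) hy.ne
  filter_upwards [eventually_all.2 hinactive] with y hy i using hy i

lemma LICQ.eventually_activeSet_eq {x g : Fin n → ℝ} {μ : P.activeSet x → ℝ} (hL : P.LICQ x)
    (hx : x ∈ P.feasible) (hg : g + (P.rows (P.activeSet x))ᵀ *ᵥ μ = 0) (hμ : ∀ j, 0 < μ j) :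
    ∀ᶠ p : (Fin n → ℝ) × (Fin n → ℝ) in 𝓝 (g, x),
      P.IsStationary p.1 p.2 → P.activeSet p.2 = P.activeSet x := by
  choose d hd hgd using fun j => hL.exists_rows_mulVec_eq_single hg j
  have hdescent (j) : ∀ᶠ p : (Fin n → ℝ) × (Fin n → ℝ) in 𝓝 (g, x), p.1 ⬝ᵥ d j < 0 := by
    have hcont : Continuous fun p : (Fin n → ℝ) × (Fin n → ℝ) => p.1 ⬝ᵥ d j := by fun_prop
    exact (hcont.tendsto (g, x)).eventually_lt_const (by simpa [hgd] using hμ j)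
  filter_upwards [eventually_all.2 hdescent,
    continuous_snd.continuousAt.eventually (eventually_activeSet_subset hx)]
    with ⟨g', y⟩ hneg hsub hst
  refine hsub.antisymm fun j hj => ?_
  by_contra hjy
  -- If `j` is inactive at `y`, moving towards it along `d j` is a feasible descent direction.
  refine (hneg ⟨j, hj⟩).not_ge (hst.dotProduct_nonneg fun i hi => ?_)
  have hij : (⟨i, hsub hi⟩ : P.activeSet x) ≠ ⟨j, hj⟩ := by
    rintro ⟨⟩
    exact hjy hi
  rw [← rows_mulVec_apply _ _ ⟨i, hsub hi⟩, hd, Pi.single_eq_of_ne hij]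

lemma IsKKT.eventually_activeSet_qpSol_eq (hρ : 0 < ρ) (hX : P.feasible.Nonempty)
    (hH : (P.H + P.Hᵀ).PosDef) {x : Fin n → ℝ} {l : Fin m → ℝ} (h : P.IsKKT x l) (hL : P.LICQ x)
    (hl : ∀ i ∈ P.activeSet x, 0 < l i) :
    ∀ᶠ z in 𝓝 x, P.activeSet (P.qpSol ρ z) = P.activeSet x := by
  have hqp := continuous_qpSol hρ hX hH
  have hcont : Continuous fun z => (P.Ht ρ *ᵥ P.qpSol ρ z + P.ft ρ z, P.qpSol ρ z) := by
    unfold ft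
    fun_prop
  have hlim := hcont.tendsto' x (P.H *ᵥ x + P.f, x) (by
    rw [(qpSol_eq_self_iff hρ hX hH).2 h.isSolution, Ht_mulVec_add_ft])
  filter_upwards [hlim.eventually (hL.eventually_activeSet_eq h.isSolution.1
    (solvesKKTSystem_iff.1 h.solvesKKTSystem).1 fun j => hl j j.2)] with z hz
  exact hz (isStationary_qpSol hρ hX hH z)

end Identification

section Termination

/-- The primal part of the solutions of the linear system with index set `S`; arbitrary if there are
none. -/
noncomputable def newtonPoint (P : AVI n m) (S : Finset (Fin m)) : Fin n → ℝ :=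
  Classical.epsilon fun x => ∃ μ, P.SolvesKKTSystem S x μ

lemma SolvesKKTSystem.eq_newtonPoint (hH : (P.H + P.Hᵀ).PosDef) {S : Finset (Fin m)}
    {x : Fin n → ℝ} {μ : S → ℝ} (h : P.SolvesKKTSystem S x μ) : x = P.newtonPoint S := by
  obtain ⟨μ', h'⟩ := Classical.epsilon_spec (p := fun x => ∃ μ, P.SolvesKKTSystem S x μ) ⟨x, μ, h⟩
  exact h.unique hH h'

/-- The residual that decides on the acceptance of the Newton step with index set `S`. -/
noncomputable def newtonResidual (P : AVI n m) (ρ : ℝ) (S : Finset (Fin m)) : ℝ≥0∞ :=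
  euclNorm (P.qpSol ρ (P.newtonPoint S) - P.newtonPoint S)

/-- The state that follows `s` unless the method returns: the next state is a function of the
current one although `Step` is only a relation. -/
noncomputable def nextState (P : AVI n m) (ρ : ℝ) (s : State n m) : State n m :=
  let S := P.activeSet (P.qpSol ρ s.z)
  let T := P.activeSet (P.qpSol ρ (P.newtonPoint S))
  if s.prev = some S then
    if P.newtonResidual ρ S < s.δ then
      ⟨P.drMap ρ (P.newtonPoint S), some T, P.newtonResidual ρ S⟩
    else ⟨P.drMap ρ s.z, some T, s.δ⟩
  else ⟨P.drMap ρ s.z, some S, s.δ⟩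

lemma Step.eq_nextState (hρ : 0 < ρ) (hX : P.feasible.Nonempty) (hH : (P.H + P.Hᵀ).PosDef)
    {s s' : State n m} (h : P.Step ρ s (.next s')) : s' = P.nextState ρ s := by
  cases h with
  | unstable y hy hprev =>
    obtain rfl := hy.eq_qpSol hρ hX hH
    simp [nextState, hprev, drMap]
  | accept y hy hprev zt μ hsys hfeas yt hyt hδ =>
    obtain rfl := hy.eq_qpSol hρ hX hH
    obtain rfl := hsys.eq_newtonPoint hH
    obtain rfl := hyt.eq_qpSol hρ hX hH
    simp [nextState, hprev, drMap, newtonResidual, hδ]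
  | reject y hy hprev zt μ hsys hfeas yt hyt hδ =>
    obtain rfl := hy.eq_qpSol hρ hX hH
    obtain rfl := hsys.eq_newtonPoint hH
    obtain rfl := hyt.eq_qpSol hρ hX hH
    simp [nextState, hprev, drMap, newtonResidual, hδ]

lemma Step.isKKT {s : State n m} {x : Fin n → ℝ} {l : Fin m → ℝ} (h : P.Step ρ s (.done x l)) :
    P.IsKKT x l := by
  cases h with
  | terminate y hy hprev _ μ hsys hfeas => exact hsys.isKKT hfeas.1 hfeas.2

lemma exists_step (hρ : 0 < ρ) (hX : P.feasible.Nonempty) (hH : (P.H + P.Hᵀ).PosDef)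
    (s : State n m) : ∃ o, P.Step ρ s o := by
  have hy := isQPSolution_qpSol hρ hX hH s.z
  by_cases hprev : s.prev = some (P.activeSet (P.qpSol ρ s.z))
  · obtain ⟨zt, μ, hsys⟩ := exists_solvesKKTSystem_activeSet hH (P.qpSol ρ s.z)
    have hyt := isQPSolution_qpSol hρ hX hH zt
    by_cases hfeas : 0 ≤ μ ∧ P.A *ᵥ zt ≤ P.b
    · exact ⟨_, .terminate _ hy hprev zt μ hsys hfeas⟩
    by_cases hδ : euclNorm (P.qpSol ρ zt - zt) < s.δ
    · exact ⟨_, .accept _ hy hprev zt μ hsys hfeas _ hyt hδ⟩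
    · exact ⟨_, .reject _ hy hprev zt μ hsys hfeas _ hyt hδ⟩
  · exact ⟨_, .unstable _ hy hprev⟩

lemma IsKKT.not_step_next (hρ : 0 < ρ) (hX : P.feasible.Nonempty) (hH : (P.H + P.Hᵀ).PosDef)
    {x : Fin n → ℝ} {l : Fin m → ℝ} (h : P.IsKKT x l) (hL : P.LICQ x) {s s' : State n m}
    (hact : P.activeSet (P.qpSol ρ s.z) = P.activeSet x) (hprev : s.prev = some (P.activeSet x)) :
    ¬ P.Step ρ s (.next s') := by
  have hset {y} (hy : P.IsQPSolution ρ s.z y) : P.activeSet y = P.activeSet x := by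
    rw [hy.eq_qpSol hρ hX hH, hact]
  have hfeasible {S : Finset (Fin m)} (hS : S = P.activeSet x) {zt} {μ : S → ℝ}
      (hsys : P.SolvesKKTSystem S zt μ) : 0 ≤ μ ∧ P.A *ᵥ zt ≤ P.b := by
    subst hS
    obtain ⟨rfl, rfl⟩ := h.eq_of_solvesKKTSystem_activeSet hH hL hsys
    exact ⟨fun i => h.2.1 i, h.isSolution.1⟩
  rintro (⟨y, hy, hne⟩ | _ | ⟨y, hy, _, zt, μ, hsys, hfeas⟩ | ⟨y, hy, _, zt, μ, hsys, hfeas⟩)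
  · exact hne (by rw [hprev, hset hy])
  · exact hfeas (hfeasible (hset hy) hsys)
  · exact hfeas (hfeasible (hset hy) hsys)

lemma IsKKT.returnsWithin_one (hρ : 0 < ρ) (hX : P.feasible.Nonempty)
    (hH : (P.H + P.Hᵀ).PosDef) {x : Fin n → ℝ} {l : Fin m → ℝ} (h : P.IsKKT x l) (hL : P.LICQ x)
    {s : State n m} (hact : P.activeSet (P.qpSol ρ s.z) = P.activeSet x)
    (hprev : s.prev = some (P.activeSet x)) : P.ReturnsWithin ρ x l 1 s := by
  refine ⟨exists_step hρ hX hH s, fun o ho => .inl ?_⟩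
  cases o with
  | next s' => exact absurd ho (h.not_step_next hρ hX hH hL hact hprev)
  | done x' l' =>
    obtain ⟨rfl, rfl⟩ := h.unique hH hL ho.isKKT
    rfl

lemma IsKKT.returnsWithin_succ (hρ : 0 < ρ) (hX : P.feasible.Nonempty)
    (hH : (P.H + P.Hᵀ).PosDef) {x : Fin n → ℝ} {l : Fin m → ℝ} (h : P.IsKKT x l) (hL : P.LICQ x)
    {s : State n m} {N : ℕ} (hN : P.ReturnsWithin ρ x l N (P.nextState ρ s)) :
    P.ReturnsWithin ρ x l (N + 1) s := by
  refine ⟨exists_step hρ hX hH s, fun o ho => ?_⟩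
  cases o with
  | next s' => exact .inr ⟨s', rfl, ho.eq_nextState hρ hX hH ▸ hN⟩
  | done x' l' =>
    obtain ⟨rfl, rfl⟩ := h.unique hH hL ho.isKKT
    exact .inl rfl

lemma IsKKT.exists_returnsWithin_of_activeSet_eq (hρ : 0 < ρ) (hX : P.feasible.Nonempty)
    (hH : (P.H + P.Hᵀ).PosDef) {x : Fin n → ℝ} {l : Fin m → ℝ} (h : P.IsKKT x l) (hL : P.LICQ x)
    {s : State n m} (hact : P.activeSet (P.qpSol ρ s.z) = P.activeSet x)
    (hact' : P.activeSet (P.qpSol ρ (P.drMap ρ s.z)) = P.activeSet x) :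
    ∃ N, P.ReturnsWithin ρ x l N s := by
  by_cases hprev : s.prev = some (P.activeSet x)
  · exact ⟨1, h.returnsWithin_one hρ hX hH hL hact hprev⟩
  · have hnext : P.nextState ρ s = ⟨P.drMap ρ s.z, some (P.activeSet x), s.δ⟩ := by
      simp [nextState, hact, hprev]
    exact ⟨2, h.returnsWithin_succ hρ hX hH hL
      (h.returnsWithin_one hρ hX hH hL (by rw [hnext, hact']) (by rw [hnext]))⟩

/-- The index sets whose Newton step can still be accepted at the threshold `δ`; every acceptance
removes one of them for good, which bounds the number of accepted steps. -/
noncomputable def acceptableSets (P : AVI n m) (ρ : ℝ) (δ : ℝ≥0∞) : Finset (Finset (Fin m)) :=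
  Finset.univ.filter fun S => P.newtonResidual ρ S < δ

lemma acceptableSets_newtonResidual_ssubset {S : Finset (Fin m)} {δ : ℝ≥0∞}
    (hS : P.newtonResidual ρ S < δ) :
    P.acceptableSets ρ (P.newtonResidual ρ S) ⊂ P.acceptableSets ρ δ := by
  refine (Finset.ssubset_iff_of_subset ?_).2
    ⟨S, by simpa [acceptableSets], by simp [acceptableSets]⟩
  exact Finset.monotone_filter_right _ fun T _ hT => hT.trans hS

lemma nextState_z_and_δ_eq_or_ssubset (s : State n m) :
    ((P.nextState ρ s).z = P.drMap ρ s.z ∧ (P.nextState ρ s).δ = s.δ) ∨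
      P.acceptableSets ρ (P.nextState ρ s).δ ⊂ P.acceptableSets ρ s.δ := by
  simp only [nextState]
  split_ifs with hprev hδ
  · exact .inr (acceptableSets_newtonResidual_ssubset hδ)
  · exact .inl ⟨rfl, rfl⟩
  · exact .inl ⟨rfl, rfl⟩

lemma IsKKT.exists_returnsWithin (hρ : 0 < ρ) (hX : P.feasible.Nonempty)
    (hH : (P.H + P.Hᵀ).PosDef) {x : Fin n → ℝ} {l : Fin m → ℝ} (h : P.IsKKT x l)
    (hL : P.LICQ x) (hl : ∀ i ∈ P.activeSet x, 0 < l i) (s : State n m) :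
    ∃ N, P.ReturnsWithin ρ x l N s := by
  induction hc : (P.acceptableSets ρ s.δ).card using Nat.strong_induction_on generalizing s with
  | _ c ih =>
  obtain ⟨K, hK⟩ := eventually_atTop.1 ((h.isSolution.tendsto_iterate_drMap hρ hX hH s.z).eventually
    (h.eventually_activeSet_qpSol_eq hρ hX hH hL hl))
  induction K generalizing s with
  | zero =>
    exact h.exists_returnsWithin_of_activeSet_eq hρ hX hH hL (hK 0 le_rfl) (hK 1 zero_le_one)
  | succ K ihK =>
    suffices hnext : ∃ N, P.ReturnsWithin ρ x l N (P.nextState ρ s) by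
      obtain ⟨N, hN⟩ := hnext
      exact ⟨N + 1, h.returnsWithin_succ hρ hX hH hL hN⟩
    rcases nextState_z_and_δ_eq_or_ssubset (P := P) (ρ := ρ) s with ⟨hz, hδ⟩ | hlt
    · refine ihK _ (by rw [hδ, hc]) fun k hk => ?_
      rw [hz]
      exact hK (k + 1) (Nat.succ_le_succ hk)
    · exact ih _ (hc ▸ Finset.card_lt_card hlt) _ rfl

end Termination

end AVI

theorem theorem2 {n m : ℕ} (P : AVI n m) (ρ : ℝ) (hρ : 0 < ρ)
    (hX : P.feasible.Nonempty)
    (hH : (P.H + P.Hᵀ).PosDef)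
    (hLICQ : ∀ x, P.IsSolution x → P.LICQ x)
    (hSC : ∀ x l, P.IsKKT x l → ∀ i ∈ P.activeSet x, 0 < l i) :
    ∃ (xs : Fin n → ℝ) (ls : Fin m → ℝ),
      (∀ x, P.IsSolution x ↔ x = xs) ∧
      (∀ x l, P.IsKKT x l ↔ x = xs ∧ l = ls) ∧
      ∀ (z₀ : Fin n → ℝ) (S₀ : Option (Finset (Fin m))),
        ∃ N : ℕ, P.ReturnsWithin ρ xs ls N ⟨z₀, S₀, ⊤⟩ := by
  obtain ⟨xs, hxs⟩ := AVI.exists_isSolution hX hH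
  have hL := hLICQ xs hxs
  obtain ⟨ls, hls⟩ := hxs.exists_isKKT hL
  refine ⟨xs, ls, fun x => ⟨fun hx => hx.unique hH hxs, ?_⟩,
    fun x l => ⟨fun hx => hls.unique hH hL hx, ?_⟩,
    fun z₀ S₀ => hls.exists_returnsWithin hρ hX hH hL (hSC xs ls hls) _⟩
  · rintro rfl
    exact hxs
  · rintro ⟨rfl, rfl⟩
    exact hls
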